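/- Let $\bar{\mathcal M}$ and $\mathcal M$ be connected, complete, finite-dimensional smooth Riemannian manifolds, let $f:\mathcal M\to\mathbb R$ be twice differentiable, let $\varphi:\bar{\mathcal M}\to\mathcal M$ be an isometry (a smooth diffeomorphism whose differential preserves the Riemannian inner products), and let $L\ge 0$. Then $f$ has a Lipschitz continuous gradient vector field with constant $L$ if and only if $g:=f\circ\varphi:\bar{\mathcal M}\to\mathbb R$ has a Lipschitz continuous gradient vector field with constant $L$. Here a differentiable function $h$ on a Riemannian manifold $\mathcal N$ is said to have a Lipschitz continuous gradient vector field with constant $L$ if $$\left\|P_{\gamma,p,q}\operatorname{grad}h(p)-\operatorname{grad}h(q)\right\|\le L\,\ell(\gamma)$$ for all $p,q\in\mathcal N$ and every (not necessarily minimal) geodesic segment $\gamma:[0,1]\to\mathcal N$ with $\gamma(0)=p$ and $\gamma(1)=q$, where $\ell(\gamma)$ is the length of $\gamma$ and $P_{\gamma,p,q}:T_p\mathcal N\to T_q\mathcal N$ is the parallel transport along $\gamma$ with respect to the Levi-Civita connection. -/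

import Mathlib

open Bundle
open scoped Manifold ContDiff Topology

noncomputable section

namespace RiemGeom

section OneManifold

variable {E : Type*} [NormedAddCommGroup E] [NormedSpace ℝ E]
  {M : Type*} [TopologicalSpace M] [ChartedSpace E M]

/-- The smooth charts of `M`: the members of its maximal `C^∞` atlas. -/
abbrev smoothCharts (E M : Type*) [NormedAddCommGroup E] [NormedSpace ℝ E]
    [TopologicalSpace M] [ChartedSpace E M] : Set (OpenPartialHomeomorph M E) :=
  IsManifold.maximalAtlas 𝓘(ℝ, E) ∞ M

/-- The velocity `γ'(t)` of a curve. -/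
def velocity (γ : ℝ → M) (t : ℝ) : TangentSpace 𝓘(ℝ, E) (γ t) :=
  mfderiv 𝓘(ℝ, ℝ) 𝓘(ℝ, E) γ t (1 : ℝ)

/-- The coordinate vector, in the chart `e`, of a tangent vector at `x`. -/
def coordVec (e : OpenPartialHomeomorph M E) (x : M) (v : TangentSpace 𝓘(ℝ, E) x) : E :=
  mfderiv 𝓘(ℝ, E) 𝓘(ℝ, E) e x v

/-- A function on a manifold is twice differentiable if, in every smooth chart, it is differentiable
and its derivative is again differentiable (no continuity of the second derivative is required). -/
def TwiceDifferentiable (E : Type*) [NormedAddCommGroup E] [NormedSpace ℝ E]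
    {M : Type*} [TopologicalSpace M] [ChartedSpace E M] (f : M → ℝ) : Prop :=
  ∀ e ∈ smoothCharts E M, ∀ y ∈ e.target,
    DifferentiableAt ℝ (f ∘ e.symm) y ∧ DifferentiableAt ℝ (fderiv ℝ (f ∘ e.symm)) y

variable [RiemannianBundle (fun x : M ↦ TangentSpace 𝓘(ℝ, E) x)]

/-- The metric tensor `g_{ij}` in the chart `e`, at the point of `M` with coordinates `y`. -/
def chartMetric (e : OpenPartialHomeomorph M E) (y : E) : E →L[ℝ] E →L[ℝ] ℝ :=
  (innerSL ℝ (E := TangentSpace 𝓘(ℝ, E) (e.symm y))).bilinearComp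
    (mfderiv 𝓘(ℝ, E) 𝓘(ℝ, E) e.symm y) (mfderiv 𝓘(ℝ, E) 𝓘(ℝ, E) e.symm y)

/-- Christoffel symbols of the first kind in the chart `e`:
`z ↦ (1/2) (∂_u g(v, z) + ∂_v g(u, z) - ∂_z g(u, v))`. -/
def christoffelFirst (e : OpenPartialHomeomorph M E) (y u v : E) : E →L[ℝ] ℝ :=
  (1 / 2 : ℝ) • (fderiv ℝ (chartMetric e) y u v + fderiv ℝ (chartMetric e) y v u
    - ((fderiv ℝ (chartMetric e) y).flip u).flip v)

/-- The Christoffel symbols `Γ(u, v)` of the Levi-Civita connection in the chart `e`, obtained from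
those of the first kind by raising an index. (The metric tensor is invertible on `e.target`, since
the manifolds considered are finite dimensional.) -/
def christoffel (e : OpenPartialHomeomorph M E) (y u v : E) : E :=
  (chartMetric e y).inverse (christoffelFirst e y u v)

/-- `V` is a parallel vector field along `γ`, on the set `s` of parameters: its covariant derivative
`∇_{γ'} V`, for the Levi-Civita connection, vanishes on `s`. In coordinates: if `v` denotes
the coordinates of `V` and `c` those of `γ`, then `v' + Γ(c', v) = 0`. -/
def IsParallelAlong (γ : ℝ → M) (V : ∀ t, TangentSpace 𝓘(ℝ, E) (γ t)) (s : Set ℝ) : Prop :=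
  ∀ e ∈ smoothCharts E M, ∀ t ∈ s, γ t ∈ e.source →
    HasDerivWithinAt (fun r ↦ coordVec e (γ r) (V r))
      (-christoffel e (e (γ t)) (coordVec e (γ t) (velocity γ t)) (coordVec e (γ t) (V t))) s t

/-- `γ` is a geodesic on the open interval `(a, b)`: it is smooth and `∇_{γ'} γ' = 0`. -/
def IsGeodesic (E : Type*) [NormedAddCommGroup E] [NormedSpace ℝ E]
    {M : Type*} [TopologicalSpace M] [ChartedSpace E M]
    [RiemannianBundle (fun x : M ↦ TangentSpace 𝓘(ℝ, E) x)] (γ : ℝ → M) (a b : ℝ) : Prop :=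
  ContMDiffOn 𝓘(ℝ, ℝ) 𝓘(ℝ, E) ∞ γ (Set.Ioo a b) ∧
    IsParallelAlong γ (velocity (E := E) γ) (Set.Ioo a b)

/-- The set `Γ_{pq}` of geodesic segments `γ : [0, 1] → M` from `p` to `q`, i.e. restrictions to
`[0, 1]` of geodesics. (Curves are functions on `ℝ`; only the values near `[0, 1]` matter.) -/
def geodesicSegments (E : Type*) [NormedAddCommGroup E] [NormedSpace ℝ E]
    {M : Type*} [TopologicalSpace M] [ChartedSpace E M]
    [RiemannianBundle (fun x : M ↦ TangentSpace 𝓘(ℝ, E) x)] (p q : M) : Set (ℝ → M) :=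
  {γ | (∃ a < 0, ∃ b > 1, IsGeodesic E γ a b) ∧ γ 0 = p ∧ γ 1 = q}

/-- The graph of parallel transport along `γ` from `γ 0` to `γ 1`: the vector `w` is the parallel
transport of `v` if `w = V(1)` for the parallel vector field `V` along `γ|[0, 1]` with
`V(0) = v`. -/
def IsParallelTransport (γ : ℝ → M) (v : TangentSpace 𝓘(ℝ, E) (γ 0))
    (w : TangentSpace 𝓘(ℝ, E) (γ 1)) : Prop :=
  ∃ V : ∀ t, TangentSpace 𝓘(ℝ, E) (γ t),
    IsParallelAlong γ V (Set.Icc 0 1) ∧ V 0 = v ∧ V 1 = w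

/-- The length of the restriction of a curve to `[0, 1]`. -/
def curveLength (E : Type*) [NormedAddCommGroup E] [NormedSpace ℝ E]
    {M : Type*} [TopologicalSpace M] [ChartedSpace E M]
    [RiemannianBundle (fun x : M ↦ TangentSpace 𝓘(ℝ, E) x)] (γ : ℝ → M) : ℝ :=
  (Manifold.pathELength 𝓘(ℝ, E) γ 0 1).toReal

variable [FiniteDimensional ℝ E]

instance completeSpace_tangentSpace (x : M) : CompleteSpace (TangentSpace 𝓘(ℝ, E) x) :=
  haveI : FiniteDimensional ℝ (TangentSpace 𝓘(ℝ, E) x) := inferInstanceAs (FiniteDimensional ℝ E)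
  FiniteDimensional.complete ℝ _

/-- The Riemannian gradient: `⟨grad f(x), v⟩ = df(x) v`. -/
def grad (E : Type*) [NormedAddCommGroup E] [NormedSpace ℝ E] [FiniteDimensional ℝ E]
    {M : Type*} [TopologicalSpace M] [ChartedSpace E M]
    [RiemannianBundle (fun x : M ↦ TangentSpace 𝓘(ℝ, E) x)]
    (f : M → ℝ) (x : M) : TangentSpace 𝓘(ℝ, E) x :=
  (InnerProductSpace.toDual ℝ (TangentSpace 𝓘(ℝ, E) x)).symm (mfderiv 𝓘(ℝ, E) 𝓘(ℝ, ℝ) f x)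

lemma inner_grad (f : M → ℝ) (x : M) (v : TangentSpace 𝓘(ℝ, E) x) :
    inner ℝ (grad E f x) v = (mfderiv 𝓘(ℝ, E) 𝓘(ℝ, ℝ) f x v : ℝ) := by
  unfold grad
  exact InnerProductSpace.toDual_symm_apply

/-- The gradient vector field of the differentiable function `f` is Lipschitz continuous with
constant `L`: `‖P_γ grad f(p) - grad f(q)‖ ≤ L ℓ(γ)` for all `p`, `q` and all geodesic segments `γ`
from `p` to `q`, where `P_γ` is parallel transport along `γ`. -/
def HasLipschitzGradient (E : Type*) [NormedAddCommGroup E] [NormedSpace ℝ E]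
    [FiniteDimensional ℝ E] {M : Type*} [TopologicalSpace M] [ChartedSpace E M]
    [RiemannianBundle (fun x : M ↦ TangentSpace 𝓘(ℝ, E) x)] (f : M → ℝ) (L : ℝ) : Prop :=
  MDifferentiable 𝓘(ℝ, E) 𝓘(ℝ, ℝ) f ∧
    ∀ p q : M, ∀ γ ∈ geodesicSegments E p q,
      ∃ w : TangentSpace 𝓘(ℝ, E) (γ 1), IsParallelTransport γ (grad E f (γ 0)) w ∧
        ‖w - grad E f (γ 1)‖ ≤ L * curveLength E γ

end OneManifold

/-- A diffeomorphism is a Riemannian isometry if its differential preserves the inner products. -/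
def IsRiemannianIsometry
    {E₁ : Type*} [NormedAddCommGroup E₁] [NormedSpace ℝ E₁]
    {M₁ : Type*} [TopologicalSpace M₁] [ChartedSpace E₁ M₁]
    [RiemannianBundle (fun x : M₁ ↦ TangentSpace 𝓘(ℝ, E₁) x)]
    {E₂ : Type*} [NormedAddCommGroup E₂] [NormedSpace ℝ E₂]
    {M₂ : Type*} [TopologicalSpace M₂] [ChartedSpace E₂ M₂]
    [RiemannianBundle (fun x : M₂ ↦ TangentSpace 𝓘(ℝ, E₂) x)]
    (φ : M₁ ≃ₘ^∞⟮𝓘(ℝ, E₁), 𝓘(ℝ, E₂)⟯ M₂) : Prop :=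
  ∀ (x : M₁) (u v : TangentSpace 𝓘(ℝ, E₁) x),
    inner ℝ (mfderiv 𝓘(ℝ, E₁) 𝓘(ℝ, E₂) φ x u) (mfderiv 𝓘(ℝ, E₁) 𝓘(ℝ, E₂) φ x v) = inner ℝ u v

end RiemGeom

end

noncomputable section

namespace RiemGeom

/-! ### Differentials of diffeomorphisms and transport of charts -/

section MFDeriv

variable {E E₁ E₂ : Type*} [NormedAddCommGroup E] [NormedSpace ℝ E]
  [NormedAddCommGroup E₁] [NormedSpace ℝ E₁] [NormedAddCommGroup E₂] [NormedSpace ℝ E₂]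
  {N M₁ M₂ : Type*} [TopologicalSpace N] [ChartedSpace E N]
  [TopologicalSpace M₁] [ChartedSpace E₁ M₁] [TopologicalSpace M₂] [ChartedSpace E₂ M₂]
  (φ : M₁ ≃ₘ^∞⟮𝓘(ℝ, E₁), 𝓘(ℝ, E₂)⟯ M₂)

/-! Everything in the Lipschitz condition is natural under isometries. For the connection this must
be seen in charts: a chart `e` of `M₂` corresponds to the chart `B ∘ e ∘ φ` of `M₁`, where the
linear isomorphism `B` only identifies the two model spaces. In such a pair of charts the metric
tensors agree up to `B`, hence so do the Christoffel symbols and the equation of parallel fields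
(`christoffel_eq`, `isParallelAlong_iff`). So `φ` maps geodesics to geodesics and `dφ` maps parallel
fields to parallel fields; it also preserves norms and lengths and takes `grad (f ∘ φ)` to `grad f`.
The estimate for `f` along `φ ∘ γ` is thus the one for `f ∘ φ` along `γ`. The converse is the same
statement for `φ.symm`. -/

lemma mdifferentiableAt_diffeomorph (x : M₁) :
    MDifferentiableAt 𝓘(ℝ, E₁) 𝓘(ℝ, E₂) φ x :=
  φ.mdifferentiable (by simp) x

/-- The chain rule for a diffeomorphism on the left, without differentiability assumption. -/
lemma mfderiv_diffeomorph_comp (g : N → M₁) (x : N) :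
    mfderiv 𝓘(ℝ, E) 𝓘(ℝ, E₂) (φ ∘ g) x =
      (mfderiv 𝓘(ℝ, E₁) 𝓘(ℝ, E₂) φ (g x)).comp (mfderiv 𝓘(ℝ, E) 𝓘(ℝ, E₁) g x) := by
  by_cases hg : MDifferentiableAt 𝓘(ℝ, E) 𝓘(ℝ, E₁) g x
  · exact mfderiv_comp x (mdifferentiableAt_diffeomorph φ (g x)) hg
  -- Composing with `φ.symm` recovers `g`, so `φ ∘ g` is not differentiable either and both
  -- derivatives take the default value `0`.
  · have hg' : ¬ MDifferentiableAt 𝓘(ℝ, E) 𝓘(ℝ, E₂) (φ ∘ g) x := fun h ↦ hg <| by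
      have := (mdifferentiableAt_diffeomorph φ.symm (φ (g x))).comp x h
      rwa [← Function.comp_assoc, show φ.symm ∘ φ = id from funext φ.symm_apply_apply] at this
    rw [mfderiv_zero_of_not_mdifferentiableAt hg, mfderiv_zero_of_not_mdifferentiableAt hg']
    exact (ContinuousLinearMap.comp_zero _).symm

/-- The chain rule for a diffeomorphism on the right, without differentiability assumption. -/
lemma mfderiv_comp_diffeomorph (g : M₂ → N) (x : M₁) :
    mfderiv 𝓘(ℝ, E₁) 𝓘(ℝ, E) (g ∘ φ) x =
      (mfderiv 𝓘(ℝ, E₂) 𝓘(ℝ, E) g (φ x)).comp (mfderiv 𝓘(ℝ, E₁) 𝓘(ℝ, E₂) φ x) := by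
  by_cases hg : MDifferentiableAt 𝓘(ℝ, E₂) 𝓘(ℝ, E) g (φ x)
  · exact mfderiv_comp x hg (mdifferentiableAt_diffeomorph φ x)
  · have hg' : ¬ MDifferentiableAt 𝓘(ℝ, E₁) 𝓘(ℝ, E) (g ∘ φ) x := fun h ↦ hg <| by
      have := MDifferentiableAt.comp (φ x) (by rwa [φ.symm_apply_apply])
        (mdifferentiableAt_diffeomorph φ.symm (φ x))
      rwa [Function.comp_assoc, show φ ∘ φ.symm = id from funext φ.apply_symm_apply] at this
    rw [mfderiv_zero_of_not_mdifferentiableAt hg, mfderiv_zero_of_not_mdifferentiableAt hg']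
    exact (ContinuousLinearMap.zero_comp _).symm

lemma mfderiv_symm_mfderiv (x : M₁) (v : TangentSpace 𝓘(ℝ, E₁) x) :
    mfderiv 𝓘(ℝ, E₂) 𝓘(ℝ, E₁) φ.symm (φ x) (mfderiv 𝓘(ℝ, E₁) 𝓘(ℝ, E₂) φ x v) = v := by
  have h := mfderiv_comp_diffeomorph (E := E₁) φ φ.symm x
  rw [show φ.symm ∘ φ = id from funext φ.symm_apply_apply, mfderiv_id] at h
  exact (DFunLike.congr_fun h v).symm

lemma mfderiv_mfderiv_symm (x : M₁) (v : TangentSpace 𝓘(ℝ, E₂) (φ x)) :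
    mfderiv 𝓘(ℝ, E₁) 𝓘(ℝ, E₂) φ x (mfderiv 𝓘(ℝ, E₂) 𝓘(ℝ, E₁) φ.symm (φ x) v) = v := by
  have h := mfderiv_diffeomorph_comp (E := E₂) φ φ.symm (φ x)
  rw [show φ ∘ φ.symm = id from funext φ.apply_symm_apply, mfderiv_id,
    φ.symm_apply_apply] at h
  exact (DFunLike.congr_fun h v).symm

/-- The differential of a diffeomorphism at a point, as an equivalence of tangent spaces. -/
def tangentEquiv (x : M₁) : TangentSpace 𝓘(ℝ, E₁) x ≃L[ℝ] TangentSpace 𝓘(ℝ, E₂) (φ x) :=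
  ContinuousLinearEquiv.equivOfInverse (mfderiv 𝓘(ℝ, E₁) 𝓘(ℝ, E₂) φ x)
    (mfderiv 𝓘(ℝ, E₂) 𝓘(ℝ, E₁) φ.symm (φ x)) (mfderiv_symm_mfderiv φ x)
    (mfderiv_mfderiv_symm φ x)

lemma mfderiv_tangentEquiv_symm (x : M₁) (w : TangentSpace 𝓘(ℝ, E₂) (φ x)) :
    mfderiv 𝓘(ℝ, E₁) 𝓘(ℝ, E₂) φ x ((tangentEquiv φ x).symm w) = w :=
  (tangentEquiv φ x).apply_symm_apply w

/-- The chart of `M₁` obtained from a chart of `M₂` by a diffeomorphism and a linear change of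
coordinates. -/
def pullbackChart (B : E₂ ≃L[ℝ] E₁) (e : OpenPartialHomeomorph M₂ E₂) :
    OpenPartialHomeomorph M₁ E₁ :=
  (φ.toHomeomorph.transOpenPartialHomeomorph e).transHomeomorph B.toHomeomorph

lemma pullbackChart_mem [IsManifold 𝓘(ℝ, E₁) ∞ M₁] [IsManifold 𝓘(ℝ, E₂) ∞ M₂]
    (B : E₂ ≃L[ℝ] E₁) {e : OpenPartialHomeomorph M₂ E₂} (he : e ∈ smoothCharts E₂ M₂) :
    pullbackChart φ B e ∈ smoothCharts E₁ M₁ := by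
  rw [smoothCharts, IsManifold.mem_maximalAtlas_iff_contMDiffOn] at he ⊢
  constructor
  · exact B.contDiff.contMDiff.comp_contMDiffOn
      (he.1.comp φ.contMDiff.contMDiffOn fun x hx ↦ hx)
  · exact φ.symm.contMDiff.comp_contMDiffOn
      (he.2.comp B.symm.contDiff.contMDiff.contMDiffOn fun x hx ↦ hx)

/-- The charts are related by an equation, not by `pullbackChart`, so that either one may be the
given chart and the other the transported one. -/
lemma coordVec_eq_of_chart_eq {B : E₂ ≃L[ℝ] E₁} {e₁ : OpenPartialHomeomorph M₁ E₁}
    {e₂ : OpenPartialHomeomorph M₂ E₂} (h : ∀ x, e₁ x = B (e₂ (φ x))) (x : M₁)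
    (v : TangentSpace 𝓘(ℝ, E₁) x) :
    coordVec e₁ x v = B (coordVec e₂ (φ x) (mfderiv 𝓘(ℝ, E₁) 𝓘(ℝ, E₂) φ x v)) := by
  have h' : (e₁ : M₁ → E₁) = B.toDiffeomorph ∘ (e₂ ∘ φ) := funext h
  rw [coordVec, h', mfderiv_diffeomorph_comp, mfderiv_comp_diffeomorph]
  have : mfderiv 𝓘(ℝ, E₂) 𝓘(ℝ, E₁) B.toDiffeomorph ((e₂ ∘ φ) x) = (B : E₂ →L[ℝ] E₁) := by
    rw [mfderiv_eq_fderiv]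
    exact B.fderiv
  rw [this]
  rfl

lemma velocity_diffeomorph_comp (γ : ℝ → M₁) (t : ℝ) :
    velocity (E := E₂) (φ ∘ γ) t =
      mfderiv 𝓘(ℝ, E₁) 𝓘(ℝ, E₂) φ (γ t) (velocity (E := E₁) γ t) :=
  DFunLike.congr_fun (mfderiv_diffeomorph_comp φ γ t) (1 : ℝ)

end MFDeriv

/-! ### Invariance of the Riemannian structures under isometries -/

section Isometry

variable {E₁ E₂ : Type*} [NormedAddCommGroup E₁] [NormedSpace ℝ E₁]
  [NormedAddCommGroup E₂] [NormedSpace ℝ E₂]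
  {M₁ M₂ : Type*} [TopologicalSpace M₁] [ChartedSpace E₁ M₁]
  [RiemannianBundle (fun x : M₁ ↦ TangentSpace 𝓘(ℝ, E₁) x)]
  [TopologicalSpace M₂] [ChartedSpace E₂ M₂]
  [RiemannianBundle (fun x : M₂ ↦ TangentSpace 𝓘(ℝ, E₂) x)]
  {φ : M₁ ≃ₘ^∞⟮𝓘(ℝ, E₁), 𝓘(ℝ, E₂)⟯ M₂}

lemma IsRiemannianIsometry.symm (hφ : IsRiemannianIsometry φ) :
    IsRiemannianIsometry φ.symm := by
  intro y u v
  obtain ⟨x, rfl⟩ : ∃ x, φ x = y := ⟨φ.symm y, φ.apply_symm_apply y⟩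
  have h := hφ x ((tangentEquiv φ x).symm u) ((tangentEquiv φ x).symm v)
  rw [mfderiv_tangentEquiv_symm, mfderiv_tangentEquiv_symm] at h
  -- The base points `φ.symm (φ x)` and `x` are only propositionally equal, so the inner products of
  -- the two fibres must be compared explicitly.
  have key : ∀ z : M₁, z = x → ∀ a b : E₁,
      @inner ℝ (TangentSpace 𝓘(ℝ, E₁) z) _ a b = @inner ℝ (TangentSpace 𝓘(ℝ, E₁) x) _ a b := by
    rintro z rfl a b
    rfl
  exact (key _ (φ.symm_apply_apply x) _ _).trans h.symm

lemma IsRiemannianIsometry.norm_mfderiv (hφ : IsRiemannianIsometry φ) (x : M₁)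
    (v : TangentSpace 𝓘(ℝ, E₁) x) : ‖mfderiv 𝓘(ℝ, E₁) 𝓘(ℝ, E₂) φ x v‖ = ‖v‖ := by
  rw [norm_eq_sqrt_real_inner, norm_eq_sqrt_real_inner v, hφ]

lemma IsRiemannianIsometry.curveLength_comp (hφ : IsRiemannianIsometry φ) (γ : ℝ → M₁) :
    curveLength E₂ (φ ∘ γ) = curveLength E₁ γ := by
  rw [curveLength, curveLength, Manifold.pathELength_eq_lintegral_mfderiv_Icc,
    Manifold.pathELength_eq_lintegral_mfderiv_Icc]
  congr 1
  refine MeasureTheory.lintegral_congr fun t ↦ ?_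
  rw [mfderiv_diffeomorph_comp]
  have h := hφ.norm_mfderiv (γ t) (mfderiv 𝓘(ℝ, ℝ) 𝓘(ℝ, E₁) γ t (1 : ℝ))
  exact enorm_eq_iff_norm_eq.2 h

/-- An isometry identifies the metric tensors in corresponding charts. -/
lemma IsRiemannianIsometry.chartMetric_eq (hφ : IsRiemannianIsometry φ) {B : E₂ ≃L[ℝ] E₁}
    {e₁ : OpenPartialHomeomorph M₁ E₁} {e₂ : OpenPartialHomeomorph M₂ E₂}
    (h : ∀ y, e₁.symm y = φ.symm (e₂.symm (B.symm y))) :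
    chartMetric e₁ = B.arrowCongr (B.arrowCongr (.refl ℝ ℝ)) ∘ chartMetric e₂ ∘ B.symm := by
  funext y
  ext u v
  have h' : (e₁.symm : E₁ → M₁) = φ.symm ∘ (e₂.symm ∘ B.symm.toDiffeomorph) := funext h
  have hB : mfderiv 𝓘(ℝ, E₁) 𝓘(ℝ, E₂) B.symm.toDiffeomorph y = (B.symm : E₁ →L[ℝ] E₂) := by
    rw [mfderiv_eq_fderiv]
    exact B.symm.fderiv
  rw [chartMetric, h', mfderiv_diffeomorph_comp, mfderiv_comp_diffeomorph, hB]
  exact hφ.symm _ _ _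

-- The coordinate change `B` is linear, so the transformation law has no second-derivative term.
-- Composition with linear equivalences commutes with `fderiv` even where the metric is not
-- differentiable.
set_option synthInstance.maxHeartbeats 100000 in
lemma IsRiemannianIsometry.christoffelFirst_eq (hφ : IsRiemannianIsometry φ) {B : E₂ ≃L[ℝ] E₁}
    {e₁ : OpenPartialHomeomorph M₁ E₁} {e₂ : OpenPartialHomeomorph M₂ E₂}
    (h : ∀ y, e₁.symm y = φ.symm (e₂.symm (B.symm y))) (y u v : E₂) :
    christoffelFirst e₁ (B y) (B u) (B v) = B.arrowCongr (.refl ℝ ℝ)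
      (christoffelFirst e₂ y u v) := by
  have hd : fderiv ℝ (chartMetric e₁) (B y) = (B.arrowCongr (B.arrowCongr (.refl ℝ ℝ)) :
      (E₂ →L[ℝ] E₂ →L[ℝ] ℝ) →L[ℝ] (E₁ →L[ℝ] E₁ →L[ℝ] ℝ)).comp
      ((fderiv ℝ (chartMetric e₂) y).comp (B.symm : E₁ →L[ℝ] E₂)) := by
    rw [hφ.chartMetric_eq h]
    refine (ContinuousLinearEquiv.comp_fderiv (𝕜 := ℝ) (E := E₂ →L[ℝ] E₂ →L[ℝ] ℝ)
      (F := E₁ →L[ℝ] E₁ →L[ℝ] ℝ) (B.arrowCongr (B.arrowCongr (.refl ℝ ℝ)))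
      (f := chartMetric e₂ ∘ B.symm)).trans ?_
    rw [ContinuousLinearEquiv.comp_right_fderiv, B.symm_apply_apply]
  ext z
  simp [christoffelFirst, hd]

/-- Raising the index commutes with `B` because `inverse` is compatible with linear equivalences on
both sides, even at points where the metric tensor is not invertible. -/
lemma IsRiemannianIsometry.christoffel_eq (hφ : IsRiemannianIsometry φ) {B : E₂ ≃L[ℝ] E₁}
    {e₁ : OpenPartialHomeomorph M₁ E₁} {e₂ : OpenPartialHomeomorph M₂ E₂}
    (h : ∀ y, e₁.symm y = φ.symm (e₂.symm (B.symm y))) (y u v : E₂) :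
    christoffel e₁ (B y) (B u) (B v) = B (christoffel e₂ y u v) := by
  have hm : chartMetric e₁ (B y) = (B.arrowCongr (.refl ℝ ℝ) : (E₂ →L[ℝ] ℝ) ≃L[ℝ] _) ∘L
      (chartMetric e₂ y ∘L (B.symm : E₁ →L[ℝ] E₂)) := by
    rw [hφ.chartMetric_eq h]
    ext u v
    simp
  rw [christoffel, christoffel, hφ.christoffelFirst_eq h, hm,
    ContinuousLinearMap.inverse_equiv_comp, ContinuousLinearMap.inverse_comp_equiv,
    ContinuousLinearMap.comp_apply, ContinuousLinearMap.comp_apply, ContinuousLinearEquiv.coe_coe,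
    ContinuousLinearEquiv.coe_coe, ContinuousLinearEquiv.symm_apply_apply, B.symm_symm]

/-- The condition in the definition of parallel fields is the same in corresponding charts. -/
lemma IsRiemannianIsometry.hasDerivWithinAt_coordVec_iff (hφ : IsRiemannianIsometry φ)
    {B : E₂ ≃L[ℝ] E₁} {e₁ : OpenPartialHomeomorph M₁ E₁} {e₂ : OpenPartialHomeomorph M₂ E₂}
    (h : ∀ x, e₁ x = B (e₂ (φ x))) (h' : ∀ y, e₁.symm y = φ.symm (e₂.symm (B.symm y)))
    (γ : ℝ → M₁) (V : ∀ t, TangentSpace 𝓘(ℝ, E₁) (γ t)) (s : Set ℝ) (t : ℝ) :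
    HasDerivWithinAt (fun r ↦ coordVec e₁ (γ r) (V r))
      (-christoffel e₁ (e₁ (γ t)) (coordVec e₁ (γ t) (velocity γ t)) (coordVec e₁ (γ t) (V t)))
      s t ↔
    HasDerivWithinAt
      (fun r ↦ coordVec e₂ (φ (γ r)) (mfderiv 𝓘(ℝ, E₁) 𝓘(ℝ, E₂) φ (γ r) (V r)))
      (-christoffel e₂ (e₂ (φ (γ t))) (coordVec e₂ (φ (γ t)) (velocity (φ ∘ γ) t))
        (coordVec e₂ (φ (γ t)) (mfderiv 𝓘(ℝ, E₁) 𝓘(ℝ, E₂) φ (γ t) (V t)))) s t := by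
  simp only [coordVec_eq_of_chart_eq φ h, h, hφ.christoffel_eq h', velocity_diffeomorph_comp]
  rw [← map_neg]
  constructor
  · intro H
    have := B.symm.hasFDerivAt.comp_hasDerivWithinAt t H
    simpa [Function.comp_def] using this
  · intro H
    exact B.hasFDerivAt.comp_hasDerivWithinAt t H

/-- Since `dφ` is onto, it suffices to pair with `dφ v`: by isometry and the chain rule both sides
give `df (dφ v)`. -/
lemma IsRiemannianIsometry.mfderiv_grad_comp (hφ : IsRiemannianIsometry φ) [FiniteDimensional ℝ E₁]
    [FiniteDimensional ℝ E₂] (f : M₂ → ℝ) (x : M₁) :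
    mfderiv 𝓘(ℝ, E₁) 𝓘(ℝ, E₂) φ x (grad E₁ (f ∘ φ) x) = grad E₂ f (φ x) := by
  refine ext_inner_right ℝ fun w ↦ ?_
  obtain ⟨v, rfl⟩ := (tangentEquiv φ x).surjective w
  change inner ℝ _ (mfderiv 𝓘(ℝ, E₁) 𝓘(ℝ, E₂) φ x v) =
    inner ℝ _ (mfderiv 𝓘(ℝ, E₁) 𝓘(ℝ, E₂) φ x v)
  rw [hφ, inner_grad, inner_grad, mfderiv_comp_diffeomorph]
  rfl

variable [IsManifold 𝓘(ℝ, E₁) ∞ M₁] [IsManifold 𝓘(ℝ, E₂) ∞ M₂]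

/-- An isometry maps the parallel fields along a curve to the parallel fields along its image. -/
lemma IsRiemannianIsometry.isParallelAlong_iff (hφ : IsRiemannianIsometry φ) (γ : ℝ → M₁)
    (V : ∀ t, TangentSpace 𝓘(ℝ, E₁) (γ t)) (s : Set ℝ) :
    IsParallelAlong (φ ∘ γ) (fun t ↦ mfderiv 𝓘(ℝ, E₁) 𝓘(ℝ, E₂) φ (γ t) (V t)) s ↔
      IsParallelAlong γ V s := by
  -- Any linear isomorphism of the model spaces would do; a differential of `φ` provides one, as
  -- tangent spaces are copies of the model space.
  let B : E₂ ≃L[ℝ] E₁ := (tangentEquiv φ (γ 0)).symm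
  constructor
  · intro H e he t ht hte
    let e₂ := pullbackChart φ.symm B.symm e
    have he₂ : ∀ x, e₂ x = B.symm (e (φ.symm x)) := fun _ ↦ rfl
    have he₂' : ∀ y, e₂.symm y = φ (e.symm (B y)) := fun _ ↦ rfl
    refine (hφ.hasDerivWithinAt_coordVec_iff (B := B) (e₂ := e₂) (by simp [he₂])
      (by simp [he₂']) γ V s t).2
      (H e₂ (pullbackChart_mem _ _ he) t ht ?_)
    change φ.symm (φ (γ t)) ∈ e.source
    rwa [φ.symm_apply_apply]
  · intro H e he t ht hte
    exact (hφ.hasDerivWithinAt_coordVec_iff (B := B) (e₁ := pullbackChart φ B e)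
      (fun _ ↦ rfl) (fun _ ↦ rfl) γ V s t).1 (H _ (pullbackChart_mem φ B he) t ht hte)

lemma IsRiemannianIsometry.isGeodesic_comp (hφ : IsRiemannianIsometry φ) {γ : ℝ → M₁} {a b : ℝ}
    (h : IsGeodesic E₁ γ a b) : IsGeodesic E₂ (φ ∘ γ) a b := by
  refine ⟨φ.contMDiff.comp_contMDiffOn h.1, ?_⟩
  rw [show velocity (E := E₂) (φ ∘ γ) = _ from funext (velocity_diffeomorph_comp φ γ)]
  exact (hφ.isParallelAlong_iff γ _ _).2 h.2

variable [FiniteDimensional ℝ E₁] [FiniteDimensional ℝ E₂]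

lemma IsRiemannianIsometry.hasLipschitzGradient_comp (hφ : IsRiemannianIsometry φ) {f : M₂ → ℝ}
    {L : ℝ} (hf : HasLipschitzGradient E₂ f L) : HasLipschitzGradient E₁ (f ∘ φ) L := by
  refine ⟨hf.1.comp (φ.mdifferentiable (by simp)), ?_⟩
  rintro p q γ ⟨⟨a, ha, b, hb, hγ⟩, hp, hq⟩
  obtain ⟨w, ⟨V, hV, hV0, hV1⟩, hw⟩ := hf.2 (φ p) (φ q) (φ ∘ γ)
    ⟨⟨a, ha, b, hb, hφ.isGeodesic_comp hγ⟩, congrArg φ hp, congrArg φ hq⟩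
  -- Pull back by `dφ` the parallel field along `φ ∘ γ` that starts at `grad f`.
  let W : ∀ t, TangentSpace 𝓘(ℝ, E₁) (γ t) := fun t ↦
    (tangentEquiv φ (γ t)).symm (V t)
  have hW : (fun t ↦ mfderiv 𝓘(ℝ, E₁) 𝓘(ℝ, E₂) φ (γ t) (W t)) = V :=
    funext fun t ↦ mfderiv_tangentEquiv_symm φ (γ t) (V t)
  refine ⟨W 1, ⟨W, ?_, ?_, rfl⟩, ?_⟩
  · rw [← hφ.isParallelAlong_iff, hW]
    exact hV
  · have h0 : V 0 = mfderiv 𝓘(ℝ, E₁) 𝓘(ℝ, E₂) φ (γ 0) (grad E₁ (f ∘ φ) (γ 0)) :=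
      hV0.trans (hφ.mfderiv_grad_comp f (γ 0)).symm
    exact (tangentEquiv φ (γ 0)).symm_apply_eq.2 h0
  · have h1 : mfderiv 𝓘(ℝ, E₁) 𝓘(ℝ, E₂) φ (γ 1) (W 1 - grad E₁ (f ∘ φ) (γ 1)) =
        w - grad E₂ f ((φ ∘ γ) 1) := by
      rw [map_sub, hφ.mfderiv_grad_comp, ← hV1]
      exact congrArg (· - grad E₂ f (φ (γ 1))) (congrFun hW 1)
    rw [← hφ.norm_mfderiv, h1, ← hφ.curveLength_comp]
    exact hw

end Isometry

end RiemGeom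

end

theorem mainTheorem6
    {E₁ : Type*} [NormedAddCommGroup E₁] [NormedSpace ℝ E₁] [FiniteDimensional ℝ E₁]
    {M₁ : Type*} [MetricSpace M₁] [ChartedSpace E₁ M₁] [IsManifold 𝓘(ℝ, E₁) ∞ M₁]
    [RiemannianBundle (fun x : M₁ ↦ TangentSpace 𝓘(ℝ, E₁) x)]
    [IsContMDiffRiemannianBundle 𝓘(ℝ, E₁) ∞ E₁ (fun x : M₁ ↦ TangentSpace 𝓘(ℝ, E₁) x)]
    [IsRiemannianManifold 𝓘(ℝ, E₁) M₁] [ConnectedSpace M₁] [CompleteSpace M₁]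
    {E₂ : Type*} [NormedAddCommGroup E₂] [NormedSpace ℝ E₂] [FiniteDimensional ℝ E₂]
    {M₂ : Type*} [MetricSpace M₂] [ChartedSpace E₂ M₂] [IsManifold 𝓘(ℝ, E₂) ∞ M₂]
    [RiemannianBundle (fun x : M₂ ↦ TangentSpace 𝓘(ℝ, E₂) x)]
    [IsContMDiffRiemannianBundle 𝓘(ℝ, E₂) ∞ E₂ (fun x : M₂ ↦ TangentSpace 𝓘(ℝ, E₂) x)]
    [IsRiemannianManifold 𝓘(ℝ, E₂) M₂] [ConnectedSpace M₂] [CompleteSpace M₂]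
    (φ : M₁ ≃ₘ^∞⟮𝓘(ℝ, E₁), 𝓘(ℝ, E₂)⟯ M₂) (hφ : RiemGeom.IsRiemannianIsometry φ)
    (f : M₂ → ℝ) (hf : RiemGeom.TwiceDifferentiable E₂ f) (L : ℝ) (hL : 0 ≤ L) :
    RiemGeom.HasLipschitzGradient E₂ f L ↔ RiemGeom.HasLipschitzGradient E₁ (f ∘ φ) L := by
  refine ⟨hφ.hasLipschitzGradient_comp, fun h ↦ ?_⟩
  have h' := hφ.symm.hasLipschitzGradient_comp h
  rwa [Function.comp_assoc, show φ ∘ φ.symm = id from funext φ.apply_symm_apply] at h'
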